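/- Let $\mathcal H$ be a separable real reproducing kernel Hilbert space of functions on a measurable space $\mathcal X$, with kernel $k$ and feature map $\phi(x)=k(x,\cdot)\in\mathcal H$. Assume that $\phi$ is measurable and that $B:=\sup_{x\in\mathcal X}k(x,x)<\infty$. Let $X_1,\dots,X_n$ ($n\ge 1$) be independent $\mathcal X$-valued random variables with common law $\mathbb P_X$, and put $z_i=\phi(X_i)$. Let $$C=\int_{\mathcal X}\langle\,\cdot\,,\phi(x)\rangle_{\mathcal H}\,\phi(x)\,d\mathbb P_X(x),\qquad C_n=\frac1n\sum_{i=1}^n\langle\,\cdot\,,z_i\rangle_{\mathcal H}\,z_i$$ be the covariance operator (a Bochner integral, which exists) and the empirical covariance operator. Let $\lambda_1\ge\lambda_2\ge\cdots\ge 0$ and $\hat\lambda^n_1\ge\hat\lambda^n_2\ge\cdots\ge 0$ be the eigenvalues of $C$ and of $C_n$, repeated according to multiplicity and padded with zeros. Then $\sum_{j\ge 1}\lambda_j=\mathrm{Tr}(C)<\infty$ and $\sum_{j=1}^n\hat\lambda_j^n=\mathrm{Tr}(C_n)$, and for every $\delta\ge 0$, with probability at least $1-2e^{-\delta}$, the following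 four bounds hold simultaneously: $$\|C-C_n\|_{\mathrm{HS}(\mathcal H)}\le\frac{2B\sqrt\delta}{\sqrt n},\qquad \sum_{j=1}^\infty(\lambda_j-\hat\lambda_j^n)^2\le\frac{4B^2\delta}{n},$$ $$\sup_j|\lambda_j-\hat\lambda_j^n|\le\frac{2B\sqrt\delta}{\sqrt n},\qquad |\mathrm{Tr}(C)-\mathrm{Tr}(C_n)|\le\frac{2B\sqrt\delta}{\sqrt n}.$$ -/

import Mathlib

open MeasureTheory ProbabilityTheory InnerProductSpace
open scoped ENNReal

namespace CovOp

noncomputable section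

section Operators

variable {H : Type*} [NormedAddCommGroup H] [InnerProductSpace ℝ H]

/-- The Hilbert-Schmidt norm `(∑ᵢ ‖T eᵢ‖²)^(1/2)`, computed in the orthonormal basis `e`, with
values in `[0, ∞]`; it is finite iff `T` is a Hilbert-Schmidt operator. By
`hsENorm_eq_hsENorm` below it does not depend on `e`. -/
def hsENorm {ι : Type*} (e : HilbertBasis ι ℝ H) (T : H →L[ℝ] H) : ℝ≥0∞ :=
  (∑' i, ‖T (e i)‖ₑ ^ 2) ^ (1 / 2 : ℝ)

/-- The trace `∑ᵢ ⟨eᵢ, T eᵢ⟩`, computed in the orthonormal basis `e`. -/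
def trace {ι : Type*} (e : HilbertBasis ι ℝ H) (T : H →L[ℝ] H) : ℝ :=
  ∑' i, inner ℝ (e i) (T (e i))

/-- The sum of the eigenspaces of `T` that belong to eigenvalues `≥ t`. -/
def upperEigenspace (T : H →L[ℝ] H) (t : ℝ) : Submodule ℝ H :=
  ⨆ s ∈ Set.Ici t, Module.End.eigenspace (T : Module.End ℝ H) s

/-- For a compact positive operator `T`, the eigenvalue number `j` (counted from `0`) in the
decreasing order, eigenvalues being repeated according to their multiplicity and the list being
padded with zeros: the largest `t > 0` such that the eigenspaces belonging to eigenvalues `≥ t`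
have total dimension at least `j + 1`, and `0` if there is no such `t`. -/
def eigenvalue (T : H →L[ℝ] H) (j : ℕ) : ℝ :=
  sSup {t : ℝ | 0 < t ∧ (j : Cardinal) < Module.rank ℝ (upperEigenspace T t)}

end Operators

section Kernel

variable {𝒳 : Type*} (H : Type*) [NormedAddCommGroup H] [InnerProductSpace ℝ H] [CompleteSpace H]
  [RKHS ℝ H 𝒳 ℝ]

/-- The reproducing kernel `k(x, y)` of the real reproducing kernel Hilbert space `H`. -/
def ker (x y : 𝒳) : ℝ := RKHS.kernel H x y 1

/-- The feature map `φ(x) = k(x, ·)`, as an element of `H`. -/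
def feature (x : 𝒳) : H := RKHS.kerFun H x 1

/-- The covariance operator `C = 𝔼[⟨·, Z⟩ Z]` of `Z = φ(X)`, where `X` has the law `P`. -/
def cov [MeasurableSpace 𝒳] (P : Measure 𝒳) : H →L[ℝ] H :=
  ∫ x, rankOne ℝ (feature H x) (feature H x) ∂P

/-- The empirical covariance operator `Cₙ = (1/n) ∑ᵢ ⟨·, zᵢ⟩ zᵢ` with `zᵢ = φ(xᵢ)`. -/
def empCov {n : ℕ} (x : Fin n → 𝒳) : H →L[ℝ] H :=
  (n : ℝ)⁻¹ • ∑ i, rankOne ℝ (feature H (x i)) (feature H (x i))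

end Kernel

section Checks

variable {H : Type*} [NormedAddCommGroup H] [InnerProductSpace ℝ H]

theorem enorm_sq_eq_tsum {ι : Type*} (e : HilbertBasis ι ℝ H) (v : H) :
    ‖v‖ₑ ^ 2 = ∑' i, ENNReal.ofReal (inner ℝ v (e i) ^ 2) := by
  have h := e.hasSum_inner_mul_inner v v
  have h' : HasSum (fun i => inner ℝ v (e i) ^ 2) (‖v‖ ^ 2) := by
    rw [← real_inner_self_eq_norm_sq]
    simpa only [real_inner_comm v, sq] using h
  rw [← ENNReal.ofReal_tsum_of_nonneg (fun i => sq_nonneg _) h'.summable, h'.tsum_eq,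
    ENNReal.ofReal_pow (norm_nonneg _), ofReal_norm]

theorem tsum_enorm_sq_eq [CompleteSpace H] {ι κ : Type*} (e : HilbertBasis ι ℝ H)
    (f : HilbertBasis κ ℝ H) (T : H →L[ℝ] H) :
    ∑' i, ‖T (e i)‖ₑ ^ 2 = ∑' k, ‖T.adjoint (f k)‖ₑ ^ 2 := by
  simp_rw [fun i => enorm_sq_eq_tsum f (T (e i)), fun k => enorm_sq_eq_tsum e (T.adjoint (f k))]
  rw [ENNReal.tsum_comm]
  simp_rw [ContinuousLinearMap.adjoint_inner_left, real_inner_comm]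

/-- The Hilbert-Schmidt norm does not depend on the orthonormal basis. -/
theorem hsENorm_eq_hsENorm [CompleteSpace H] {ι κ : Type*} (e : HilbertBasis ι ℝ H)
    (f : HilbertBasis κ ℝ H) (T : H →L[ℝ] H) : hsENorm e T = hsENorm f T := by
  rw [hsENorm, hsENorm, tsum_enorm_sq_eq e f T, tsum_enorm_sq_eq f f T]

/-- `k(x, y) = ⟨φ(y), φ(x)⟩`. -/
theorem ker_eq_inner {𝒳 : Type*} [CompleteSpace H] [RKHS ℝ H 𝒳 ℝ] (x y : 𝒳) :
    ker H x y = inner ℝ (feature H y) (feature H x) := by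
  rw [feature, feature, ← RKHS.kernel_inner]
  simp [ker]

end Checks

end

end CovOp

/-! Both operators are second moments `∫ ⟨·, z⟩ z` of the feature map: `C` for the law, `Cₙ` for the
empirical measure. Every statement about `secondMoment` therefore serves both. The problem splits
into a probabilistic estimate and a deterministic spectral inequality.

Probability: the centered operator `⟨·, z⟩ z - C` and the centered trace `‖z‖² - Tr C` form one
vector, `centeredSquare`, in a Hilbert space. Its norm is at most `√2 B` (`norm_centeredSquare_le`),
so Pinelis' inequality (`measureReal_lt_norm_sum_le`) puts the average of the sample within
`2B√δ/√n` of zero, outside an event of probability at most `2 exp (-δ)`. The Hilbert-Schmidt and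
trace bounds hold together on one event, without a union bound.

Spectrum: the Hoffman-Wielandt inequality (`tsum_eigenvalue_sub_sq_le`) bounds the squared `ℓ²`
distance of the ordered eigenvalues by `‖C - Cₙ‖²_HS`, hence also the supremum. In eigenbases `b`,
`c` the latter is `∑ (aᵢ - wₖ)² ⟨bᵢ, cₖ⟩²` with a doubly stochastic weight, and a rearrangement
inequality shows that no such coupling beats pairing the eigenvalues in decreasing order. Ordered
lists are compared only through their counting functions at levels `s ≥ 0`, which suits layer-cake
integrals and the definition of `eigenvalue`. -/

namespace CovOp

/-! ### Decreasing rearrangements by layer-cake integrals -/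

/-- The sequence `l` is the decreasing rearrangement of the positive values of the family `a`. -/
def IsRearrangement {I : Type*} (a : I → ℝ) (l : ℕ → ℝ) : Prop :=
  ∀ s : ℝ, 0 ≤ s → ∀ j : ℕ, s < l j ↔ (j : ℕ∞) < {i | s < a i}.encard

theorem encard_setOf_natCast_lt (N : ℕ∞) : {j : ℕ | (j : ℕ∞) < N}.encard = N := by
  induction N using ENat.recTopCoe with
  | top => simp
  | coe n =>
    have : {j : ℕ | (j : ℕ∞) < n} = (Finset.range n : Set ℕ) := by ext; simp
    rw [this, Set.encard_coe_eq_coe_finsetCard, Finset.card_range]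

theorem tsum_ite_one_eq_encard {I : Type*} (p : I → Prop) [DecidablePred p] :
    ∑' i, (if p i then 1 else 0 : ℝ≥0∞) = ({i | p i}.encard : ℝ≥0∞) := by
  rw [← ENNReal.tsum_set_one, tsum_subtype {i | p i} (fun _ => (1 : ℝ≥0∞))]
  exact tsum_congr fun i => by simp [Set.indicator_apply]

theorem ofReal_eq_lintegral_ite (x : ℝ) :
    ENNReal.ofReal x = ∫⁻ s in Set.Ici (0 : ℝ), if s < x then 1 else 0 := by
  have h : (fun s : ℝ => if s < x then (1 : ℝ≥0∞) else 0) = (Set.Iio x).indicator 1 := by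
    ext s; simp [Set.indicator_apply]
  rw [h, lintegral_indicator_one measurableSet_Iio, Measure.restrict_apply measurableSet_Iio]
  rw [Set.inter_comm, Set.Ici_inter_Iio, Real.volume_Ico, sub_zero]

theorem measurable_ite_lt (x : ℝ) : Measurable fun s : ℝ => if s < x then (1 : ℝ≥0∞) else 0 :=
  Measurable.ite measurableSet_Iio measurable_const measurable_const

theorem tsum_ofReal_eq_lintegral {I : Type*} [Countable I] (a : I → ℝ) :
    ∑' i, ENNReal.ofReal (a i) = ∫⁻ s in Set.Ici (0 : ℝ), ({i | s < a i}.encard : ℝ≥0∞) := by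
  simp_rw [ofReal_eq_lintegral_ite (a _)]
  rw [← lintegral_tsum fun i => (measurable_ite_lt _).aemeasurable]
  simp_rw [tsum_ite_one_eq_encard]

theorem IsRearrangement.encard_eq {I : Type*} {a : I → ℝ} {l : ℕ → ℝ} (h : IsRearrangement a l)
    {s : ℝ} (hs : 0 ≤ s) : {j | s < l j}.encard = {i | s < a i}.encard := by
  simp_rw [h s hs, encard_setOf_natCast_lt]

/-- By the layer-cake formula, the sum of positive parts depends only on the counting function. -/
theorem IsRearrangement.tsum_eq {I : Type*} [Countable I] {a : I → ℝ} {l : ℕ → ℝ}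
    (h : IsRearrangement a l) : ∑' j, ENNReal.ofReal (l j) = ∑' i, ENNReal.ofReal (a i) := by
  rw [tsum_ofReal_eq_lintegral, tsum_ofReal_eq_lintegral]
  refine setLIntegral_congr_fun measurableSet_Ici fun s hs => ?_
  simp only [h.encard_eq hs]

theorem IsRearrangement.sq {I : Type*} {a : I → ℝ} {l : ℕ → ℝ} (h : IsRearrangement a l)
    (ha : ∀ i, 0 ≤ a i) (hl : ∀ j, 0 ≤ l j) :
    IsRearrangement (fun i => a i ^ 2) (fun j => l j ^ 2) := by
  have key : ∀ {s x : ℝ}, 0 ≤ s → 0 ≤ x → (s < x ^ 2 ↔ √s < x) := fun {s x} hs hx => by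
    rw [← Real.sqrt_lt_sqrt_iff hs, Real.sqrt_sq hx]
  intro s hs j
  simp_rw [key hs (hl _), key hs (ha _)]
  exact h _ (Real.sqrt_nonneg s) j

theorem ofReal_mul_ofReal_eq_lintegral (x y : ℝ) :
    ENNReal.ofReal x * ENNReal.ofReal y = ∫⁻ s in Set.Ici (0 : ℝ), ∫⁻ t in Set.Ici (0 : ℝ),
      (if s < x then 1 else 0) * (if t < y then 1 else 0) := by
  simp_rw [lintegral_const_mul _ (measurable_ite_lt y), ← ofReal_eq_lintegral_ite]
  rw [lintegral_mul_const _ (measurable_ite_lt x), ← ofReal_eq_lintegral_ite]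

theorem tsum_mul_mul_eq_lintegral {J : Type*} [Countable J] (x y : J → ℝ) (p : J → ℝ≥0∞) :
    ∑' j, ENNReal.ofReal (x j) * ENNReal.ofReal (y j) * p j =
      ∫⁻ s in Set.Ici (0 : ℝ), ∫⁻ t in Set.Ici (0 : ℝ),
        ∑' j, (if s < x j then 1 else 0) * (if t < y j then 1 else 0) * p j := by
  have hm : ∀ j, Measurable (Function.uncurry fun s t : ℝ =>
      (if s < x j then (1 : ℝ≥0∞) else 0) * (if t < y j then 1 else 0) * p j) := fun j =>
    (((measurable_ite_lt (x j)).comp measurable_fst).mul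
      ((measurable_ite_lt (y j)).comp measurable_snd)).mul_const _
  have h1 : ∀ s : ℝ, ∫⁻ t in Set.Ici (0 : ℝ),
        ∑' j, (if s < x j then 1 else 0) * (if t < y j then 1 else 0) * p j =
      ∑' j, ∫⁻ t in Set.Ici (0 : ℝ),
        (if s < x j then 1 else 0) * (if t < y j then 1 else 0) * p j := fun s =>
    lintegral_tsum fun j => ((hm j).comp measurable_prodMk_left).aemeasurable
  simp_rw [h1]
  rw [lintegral_tsum]
  swap
  · exact fun j => (hm j).lintegral_prod_right.aemeasurable
  refine tsum_congr fun j => ?_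
  rw [ofReal_mul_ofReal_eq_lintegral, ← lintegral_mul_const]
  · refine lintegral_congr fun s => ?_
    rw [lintegral_mul_const]
    exact (measurable_ite_lt (y j)).const_mul _
  · exact Measurable.lintegral_prod_right' (f := fun q : ℝ × ℝ =>
      (if q.1 < x j then (1 : ℝ≥0∞) else 0) * (if q.2 < y j then 1 else 0))
      (((measurable_ite_lt (x j)).comp measurable_fst).mul
      ((measurable_ite_lt (y j)).comp measurable_snd))

/-- The rearrangement inequality for a doubly substochastic matrix. -/
theorem IsRearrangement.tsum_mul_le {I K : Type*} [Countable I] [Countable K]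
    {a : I → ℝ} {c : K → ℝ} {l m : ℕ → ℝ} (ha : IsRearrangement a l) (hc : IsRearrangement c m)
    {p : I → K → ℝ≥0∞} (hp : ∀ i, ∑' k, p i k ≤ 1) (hp' : ∀ k, ∑' i, p i k ≤ 1) :
    ∑' q : I × K, ENNReal.ofReal (a q.1) * ENNReal.ofReal (c q.2) * p q.1 q.2 ≤
      ∑' j, ENNReal.ofReal (l j) * ENNReal.ofReal (m j) := by
  have hr := tsum_mul_mul_eq_lintegral l m 1
  simp only [Pi.one_apply, mul_one] at hr
  rw [tsum_mul_mul_eq_lintegral (fun q : I × K => a q.1) (fun q => c q.2) (fun q => p q.1 q.2), hr]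
  refine setLIntegral_mono' measurableSet_Ici fun s hs => ?_
  refine setLIntegral_mono' measurableSet_Ici fun t ht => ?_
  -- For ordered lists the two level sets are initial segments of `ℕ`, so their intersection has the
  -- smaller of the two cardinalities. A substochastic weight gives the product of the level sets of
  -- `a` and `c` at most this mass, by row sums and by column sums.
  have h1 : ∑' j, (if s < l j then 1 else 0 : ℝ≥0∞) * (if t < m j then 1 else 0) =
      ((min {i | s < a i}.encard {k | t < c k}.encard : ℕ∞) : ℝ≥0∞) := by
    rw [← encard_setOf_natCast_lt (min _ _), ← tsum_ite_one_eq_encard]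
    refine tsum_congr fun j => ?_
    simp only [ha s hs j, hc t ht j, lt_min_iff]
    split_ifs <;> simp_all
  rw [h1]
  have h2 : ∑' q : I × K, (if s < a q.1 then 1 else 0 : ℝ≥0∞) * (if t < c q.2 then 1 else 0)
      * p q.1 q.2 ≤ ({i | s < a i}.encard : ℝ≥0∞) := by
    rw [ENNReal.tsum_prod', ← tsum_ite_one_eq_encard]
    refine ENNReal.tsum_le_tsum fun i => ?_
    split_ifs
    · refine le_trans (ENNReal.tsum_le_tsum fun k => ?_) (hp i)
      split_ifs <;> simp
    · simp
  have h3 : ∑' q : I × K, (if s < a q.1 then 1 else 0 : ℝ≥0∞) * (if t < c q.2 then 1 else 0)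
      * p q.1 q.2 ≤ ({k | t < c k}.encard : ℝ≥0∞) := by
    rw [ENNReal.tsum_prod', ENNReal.tsum_comm, ← tsum_ite_one_eq_encard]
    refine ENNReal.tsum_le_tsum fun k => ?_
    split_ifs
    · refine le_trans (ENNReal.tsum_le_tsum fun i => ?_) (hp' k)
      split_ifs <;> simp
    · simp
  rcases min_choice {i | s < a i}.encard {k | t < c k}.encard with h | h <;> rw [h]
  · exact h2
  · exact h3

/-- Distinct orthonormal vectors are at distance `√2 > 1`, so the balls of radius `1/2` around them
are disjoint open sets. -/
theorem _root_.Orthonormal.countable_of_separableSpace {H : Type*} [NormedAddCommGroup H]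
    [InnerProductSpace ℝ H] [TopologicalSpace.SeparableSpace H] {I : Type*} {v : I → H}
    (hv : Orthonormal ℝ v) : Countable I := by
  have hd : ∀ i j, i ≠ j → 1 < dist (v i) (v j) := fun i j hij => by
    have h := norm_sub_sq_real (v i) (v j)
    rw [hv.2 hij, hv.1 i, hv.1 j] at h
    rw [dist_eq_norm]
    nlinarith [norm_nonneg (v i - v j)]
  refine Pairwise.countable_of_isOpen_disjoint (s := fun i => Metric.ball (v i) (1 / 2))
    (fun i j hij => ?_) (fun i => Metric.isOpen_ball)
    (fun i => ⟨v i, Metric.mem_ball_self (by norm_num)⟩)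
  exact Metric.ball_disjoint_ball (by linarith [hd i j hij])

/-! ### Eigenbases and the ordered eigenvalues -/

section Eigenvalue

variable {H : Type*} [NormedAddCommGroup H] [InnerProductSpace ℝ H]

theorem exists_hilbertBasis_of_orthogonalFamily [CompleteSpace H] {S : Type*}
    {E : S → Submodule ℝ H} (hc : ∀ s, IsClosed (E s : Set H))
    (hE : OrthogonalFamily ℝ (fun s => E s) fun s => (E s).subtypeₗᵢ) (hE' : (⨆ s, E s)ᗮ = ⊥) :
    ∃ (w : (s : S) → Set (E s)) (b : HilbertBasis (Σ s, w s) ℝ H), ∀ q, b q ∈ E q.1 := by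
  have hcs : ∀ s, CompleteSpace (E s) := fun s => (hc s).completeSpace_coe
  choose w b hb using fun s => exists_hilbertBasis ℝ (E s)
  let v : (Σ s, w s) → H := fun q => (b q.1 q.2 : H)
  have hv : Orthonormal ℝ v :=
    hE.orthonormal_sigma_orthonormal fun s => (b s).orthonormal
  have hsp : (Submodule.span ℝ (Set.range v))ᗮ = ⊥ := by
    rw [eq_bot_iff, ← hE', ← Submodule.iInf_orthogonal]
    refine le_iInf fun s x hx => ?_
    rw [Submodule.mem_orthogonal] at hx ⊢
    intro u hu
    have h0 : HasSum (fun i => inner ℝ x (((b s).repr ⟨u, hu⟩ i • b s i : E s) : H))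
        (inner ℝ x u) :=
      (((b s).hasSum_repr ⟨u, hu⟩).mapL (E s).subtypeL).mapL (innerSL ℝ x)
    rw [real_inner_comm]
    refine h0.unique ?_
    convert hasSum_zero with i
    have h1 : inner ℝ (v ⟨s, i⟩) x = 0 := hx _ (Submodule.subset_span ⟨⟨s, i⟩, rfl⟩)
    rw [Submodule.coe_smul, inner_smul_right, real_inner_comm]
    exact mul_eq_zero_of_right _ h1
  refine ⟨w, HilbertBasis.mkOfOrthogonalEqBot hv hsp, fun q => ?_⟩
  rw [HilbertBasis.coe_mkOfOrthogonalEqBot]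
  exact (b q.1 q.2).2

theorem exists_hilbertBasis_eigenvectors.{u} {H : Type u} [NormedAddCommGroup H]
    [InnerProductSpace ℝ H] [CompleteSpace H] {T : H →L[ℝ] H}
    (hT : IsCompactOperator T) (hT' : T.IsSymmetric) :
    ∃ (I : Type u) (b : HilbertBasis I ℝ H) (a : I → ℝ), ∀ i, T (b i) = a i • b i := by
  have hc : ∀ s : ℝ, IsClosed (Module.End.eigenspace (T : Module.End ℝ H) s : Set H) := fun s => by
    have : (Module.End.eigenspace (T : Module.End ℝ H) s : Set H) = {x | T x = s • x} := by
      ext x; exact Module.End.mem_eigenspace_iff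
    rw [this]
    exact isClosed_eq T.continuous (continuous_const_smul s)
  obtain ⟨w, b, hb⟩ := exists_hilbertBasis_of_orthogonalFamily hc hT'.orthogonalFamily_eigenspaces
    (ContinuousLinearMap.orthogonalComplement_iSup_eigenspaces_eq_bot hT hT')
  have hb' : ∀ q : (Σ s, w s), T (b q) = q.1 • b q := fun q => by
    have h := Module.End.mem_eigenspace_iff.1 (hb q)
    exact h
  exact ⟨(Σ s, w s), b, fun q => q.1, hb'⟩

/-- By symmetry, an eigenvector for `s ≥ t` is orthogonal to each `b i` with `a i < t`. Finiteness
of the level set makes its expansion a finite sum, so the algebraic span needs no closure. -/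
theorem upperEigenspace_eq_span {T : H →L[ℝ] H} (hT : T.IsSymmetric)
    {I : Type*} (b : HilbertBasis I ℝ H) {a : I → ℝ} (hb : ∀ i, T (b i) = a i • b i)
    {t : ℝ} (hfin : {i | t ≤ a i}.Finite) :
    upperEigenspace T t = Submodule.span ℝ (b '' {i | t ≤ a i}) := by
  refine le_antisymm (iSup₂_le fun s hs x hx => ?_) (Submodule.span_le.2 ?_)
  · have hx' : T x = s • x := Module.End.mem_eigenspace_iff.1 hx
    have h0 : ∀ i, i ∉ hfin.toFinset → b.repr x i • b i = 0 := fun i hi => by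
      have h1 : inner ℝ (T (b i)) x = inner ℝ (b i) (T x) := hT (b i) x
      rw [hb, hx', inner_smul_left, inner_smul_right] at h1
      have h2 : (a i - s) * inner ℝ (b i) x = 0 := by
        simp only [conj_trivial] at h1; linarith
      rw [Set.Finite.mem_toFinset, Set.mem_ofPred_eq, not_le] at hi
      rw [b.repr_apply_apply, (mul_eq_zero.1 h2).resolve_left, zero_smul]
      have : t ≤ s := hs
      intro h; linarith
    rw [(b.hasSum_repr x).unique (hasSum_sum_of_ne_finset_zero h0)]
    refine Submodule.sum_mem _ fun i hi => Submodule.smul_mem _ _ (Submodule.subset_span ?_)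
    exact ⟨i, (Set.Finite.mem_toFinset _).1 hi, rfl⟩
  · rintro _ ⟨i, hi, rfl⟩
    exact Submodule.mem_iSup_of_mem (a i) (Submodule.mem_iSup_of_mem hi
      (Module.End.mem_eigenspace_iff.2 (hb i)))

theorem eigenvalue_nonneg (T : H →L[ℝ] H) (j : ℕ) : 0 ≤ eigenvalue T j :=
  Real.sSup_nonneg fun _ ht => ht.1.le

theorem isRearrangement_eigenvalue {T : H →L[ℝ] H} (hT : T.IsSymmetric)
    {I : Type*} (b : HilbertBasis I ℝ H) {a : I → ℝ} (hb : ∀ i, T (b i) = a i • b i)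
    (hfin : ∀ t > 0, {i | t ≤ a i}.Finite) : IsRearrangement a (eigenvalue T) := by
  have hrank : ∀ (t : ℝ) (j : ℕ), 0 < t → ((j : Cardinal) < Module.rank ℝ (upperEigenspace T t) ↔
      (j : ℕ∞) < {i | t ≤ a i}.encard) := fun t j ht => by
    rw [upperEigenspace_eq_span hT b hb (hfin t ht), ← Cardinal.natCast_lt_toENat,
      toENat_rank_span_set (b.orthonormal.linearIndependent.linearIndepOn _)]
  intro s hs j
  constructor
  · intro h
    -- The real supremum of the empty set is `0`, which `0 ≤ s < eigenvalue T j` excludes.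
    have hne : {t : ℝ | 0 < t ∧ (j : Cardinal) < Module.rank ℝ (upperEigenspace T t)}.Nonempty := by
      by_contra hne
      rw [Set.not_nonempty_iff_eq_empty] at hne
      rw [eigenvalue, hne, Real.sSup_empty] at h
      exact absurd h hs.not_gt
    obtain ⟨t, ⟨ht, hj⟩, hst⟩ := exists_lt_of_lt_csSup hne h
    exact ((hrank t j ht).1 hj).trans_le (Set.encard_le_encard fun i hi => hst.trans_le hi)
  · intro h
    obtain ⟨F, hF, hFc⟩ := Set.exists_subset_encard_eq (Order.add_one_le_of_lt h)
    have hFf : F.Finite := by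
      refine Set.finite_of_encard_eq_coe (k := j + 1) ?_
      rw [hFc]; simp
    have hFn : F.Nonempty := by
      rw [← Set.encard_pos, hFc]; simp
    -- The smallest value on `j + 1` indices above level `s` is an admissible threshold, still
    -- strictly larger than `s`.
    obtain ⟨i₀, hi₀, hmin⟩ := hFf.exists_minimalFor a F hFn |>.imp fun i h =>
      (⟨h.1, fun k hk => (le_total (a i) (a k)).elim id (h.2 hk)⟩ :
        i ∈ F ∧ ∀ k ∈ F, a i ≤ a k)
    have hs0 : s < a i₀ := hF hi₀
    have ht : 0 < a i₀ := hs.trans_lt hs0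
    refine hs0.trans_le (le_csSup ?_ ⟨ht, (hrank _ j ht).2 ?_⟩)
    · refine ⟨‖T‖, fun t ⟨ht, hj⟩ => ?_⟩
      have h1 := (hrank t j ht).1 hj
      obtain ⟨i, hi⟩ := Set.encard_pos.1 (bot_le.trans_lt h1)
      have h2 := T.le_opNorm (b i)
      rw [hb, norm_smul, b.orthonormal.1 i, mul_one, mul_one] at h2
      exact (hi.out.trans (le_abs_self _)).trans h2
    · refine lt_of_lt_of_le ?_ (Set.encard_le_encard (s := F) fun k hk => hmin k hk)
      rw [hFc]
      exact_mod_cast Nat.lt_succ_self j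

end Eigenvalue

/-! ### Second moment operators, their trace and spectrum -/

theorem integrable_norm_sq {E : Type*} [NormedAddCommGroup E] {𝒳 : Type*} [MeasurableSpace 𝒳]
    {z : 𝒳 → E} {P : Measure 𝒳} [IsFiniteMeasure P] {B : ℝ} (hz : StronglyMeasurable z)
    (hB : ∀ x, ‖z x‖ ^ 2 ≤ B) :
    Integrable (fun x => ‖z x‖ ^ 2) P := by
  refine Integrable.of_bound (hz.norm.pow 2).aestronglyMeasurable B (ae_of_all _ fun x => ?_)
  simpa using hB x

section SecondMoment

variable {H : Type*} [NormedAddCommGroup H] [InnerProductSpace ℝ H]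
  {𝒳 : Type*} [MeasurableSpace 𝒳]

/-- The second moment operator `∫ ⟨·, z⟩ z dP` of an `H`-valued random variable. -/
noncomputable def secondMoment (z : 𝒳 → H) (P : Measure 𝒳) : H →L[ℝ] H :=
  ∫ x, rankOne ℝ (z x) (z x) ∂P

variable {z : 𝒳 → H} {P : Measure 𝒳} [IsFiniteMeasure P] {B : ℝ}

theorem integrable_rankOne (hz : StronglyMeasurable z) (hB : ∀ x, ‖z x‖ ^ 2 ≤ B) :
    Integrable (fun x => rankOne ℝ (z x) (z x)) P := by
  have hc : Continuous fun v : H => rankOne ℝ v v :=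
    (rankOne ℝ (E := H) (F := H)).continuous.clm_apply continuous_id
  refine Integrable.of_bound (hc.comp_stronglyMeasurable hz).aestronglyMeasurable B
    (ae_of_all _ fun x => ?_)
  simpa only [norm_rankOne, sq] using hB x

theorem integrable_inner_mul_inner (hz : StronglyMeasurable z) (hB : ∀ x, ‖z x‖ ^ 2 ≤ B)
    (v w : H) : Integrable (fun x => inner ℝ (z x) v * inner ℝ (z x) w) P := by
  refine Integrable.of_bound ((hz.inner stronglyMeasurable_const).mul
    (hz.inner stronglyMeasurable_const)).aestronglyMeasurable (B * (‖v‖ * ‖w‖))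
    (ae_of_all _ fun x => ?_)
  rw [norm_mul]
  calc ‖inner ℝ (z x) v‖ * ‖inner ℝ (z x) w‖ ≤ (‖z x‖ * ‖v‖) * (‖z x‖ * ‖w‖) :=
        mul_le_mul (norm_inner_le_norm _ _) (norm_inner_le_norm _ _) (norm_nonneg _)
          (by positivity)
    _ = ‖z x‖ ^ 2 * (‖v‖ * ‖w‖) := by ring
    _ ≤ B * (‖v‖ * ‖w‖) := by gcongr; exact hB x

theorem secondMoment_apply (hz : StronglyMeasurable z) (hB : ∀ x, ‖z x‖ ^ 2 ≤ B) (v : H) :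
    secondMoment z P v = ∫ x, inner ℝ (z x) v • z x ∂P := by
  rw [secondMoment, ContinuousLinearMap.integral_apply (integrable_rankOne hz hB)]
  simp

variable [CompleteSpace H]

theorem inner_secondMoment (hz : StronglyMeasurable z) (hB : ∀ x, ‖z x‖ ^ 2 ≤ B) (v w : H) :
    inner ℝ (secondMoment z P v) w = ∫ x, inner ℝ (z x) v * inner ℝ (z x) w ∂P := by
  have hi : Integrable (fun x => inner ℝ (z x) v • z x) P := by
    simpa using (integrable_rankOne (P := P) hz hB).apply_continuousLinearMap v
  rw [secondMoment_apply hz hB, real_inner_comm, ← integral_inner hi]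
  simp_rw [inner_smul_right, real_inner_comm]

theorem isSymmetric_secondMoment (hz : StronglyMeasurable z) (hB : ∀ x, ‖z x‖ ^ 2 ≤ B) :
    (secondMoment z P).IsSymmetric := fun v w => by
  change inner ℝ (secondMoment z P v) w = inner ℝ v (secondMoment z P w)
  rw [real_inner_comm (secondMoment z P w) v, inner_secondMoment hz hB, inner_secondMoment hz hB]
  simp_rw [mul_comm]

/-- Compact operators form a closed convex set, which contains the mean of its rank-one integrand.
-/
theorem isCompactOperator_secondMoment [IsProbabilityMeasure P] (hz : StronglyMeasurable z)
    (hB : ∀ x, ‖z x‖ ^ 2 ≤ B) : IsCompactOperator (secondMoment z P) := by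
  have h := Convex.integral_mem (μ := P) (s := {T : H →L[ℝ] H | IsCompactOperator T})
    (compactOperator (RingHom.id ℝ) H H).convex isClosed_setOfPred_isCompactOperator
    (ae_of_all _ fun x => ?_) (integrable_rankOne hz hB)
  · exact h
  · have : IsCompactOperator (ContinuousLinearMap.toSpanSingleton ℝ (z x)) :=
      isCompactOperator_of_locallyCompactSpace_rng _
    exact this.comp_clm (innerSL ℝ (z x))

/-- Parseval's identity for `z x`, integrated term by term; the series is nonnegative and so
dominates itself. -/
theorem hasSum_inner_secondMoment {I : Type*} [Countable I] (f : HilbertBasis I ℝ H)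
    (hz : StronglyMeasurable z) (hB : ∀ x, ‖z x‖ ^ 2 ≤ B) :
    HasSum (fun i => inner ℝ (f i) (secondMoment z P (f i))) (∫ x, ‖z x‖ ^ 2 ∂P) := by
  have h1 : ∀ x, HasSum (fun i => inner ℝ (z x) (f i) * inner ℝ (z x) (f i)) (‖z x‖ ^ 2) :=
    fun x => by
      have h := f.hasSum_inner_mul_inner (z x) (z x)
      rw [real_inner_self_eq_norm_sq] at h
      simpa only [real_inner_comm (z x)] using h
  have h2 : ∀ i, inner ℝ (f i) (secondMoment z P (f i)) =
      ∫ x, inner ℝ (z x) (f i) * inner ℝ (z x) (f i) ∂P := fun i => by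
    rw [real_inner_comm, inner_secondMoment hz hB]
  simp_rw [h2]
  refine hasSum_integral_of_dominated_convergence
    (fun i x => inner ℝ (z x) (f i) * inner ℝ (z x) (f i))
    (fun i => (integrable_inner_mul_inner hz hB _ _).aestronglyMeasurable)
    (fun i => ae_of_all _ fun x => ?_) (ae_of_all _ fun x => (h1 x).summable) ?_
    (ae_of_all _ h1)
  · rw [Real.norm_of_nonneg (mul_self_nonneg _)]
  · simp_rw [(h1 _).tsum_eq]
    exact integrable_norm_sq hz hB

theorem trace_secondMoment {I : Type*} [Countable I] (f : HilbertBasis I ℝ H)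
    (hz : StronglyMeasurable z) (hB : ∀ x, ‖z x‖ ^ 2 ≤ B) :
    trace f (secondMoment z P) = ∫ x, ‖z x‖ ^ 2 ∂P :=
  (hasSum_inner_secondMoment f hz hB).tsum_eq

end SecondMoment

section Spectral

universe u

variable {H : Type u} [NormedAddCommGroup H] [InnerProductSpace ℝ H] [CompleteSpace H]
  [TopologicalSpace.SeparableSpace H]
  {𝒳 : Type*} [MeasurableSpace 𝒳] {z : 𝒳 → H} {P : Measure 𝒳} [IsProbabilityMeasure P] {B : ℝ}

theorem exists_eigenbasis_secondMoment (hz : StronglyMeasurable z) (hB : ∀ x, ‖z x‖ ^ 2 ≤ B) :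
    ∃ (I : Type u) (b : HilbertBasis I ℝ H) (a : I → ℝ), Countable I ∧
      (∀ i, secondMoment z P (b i) = a i • b i) ∧ (∀ i, 0 ≤ a i) ∧
      HasSum a (∫ x, ‖z x‖ ^ 2 ∂P) ∧ IsRearrangement a (eigenvalue (secondMoment z P)) := by
  have hsym := isSymmetric_secondMoment (P := P) hz hB
  obtain ⟨I, b, a, hb⟩ := exists_hilbertBasis_eigenvectors
    (isCompactOperator_secondMoment (P := P) hz hB) hsym
  have hI : Countable I := b.orthonormal.countable_of_separableSpace
  have ha : ∀ i, a i = inner ℝ (b i) (secondMoment z P (b i)) := fun i => by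
    rw [hb, inner_smul_right, real_inner_self_eq_norm_sq, b.orthonormal.1 i]; simp
  have hs : HasSum a (∫ x, ‖z x‖ ^ 2 ∂P) := by
    rw [funext ha]; exact hasSum_inner_secondMoment b hz hB
  refine ⟨I, b, a, hI, hb, fun i => ?_, hs, isRearrangement_eigenvalue hsym b hb fun t ht => ?_⟩
  · rw [ha, real_inner_comm, inner_secondMoment hz hB]
    exact integral_nonneg fun x => mul_self_nonneg _
  -- The eigenvalues are summable, so only finitely many reach a positive level.
  · have h := hs.summable.tendsto_cofinite_zero.eventually (gt_mem_nhds ht)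
    rw [Filter.eventually_cofinite] at h
    simpa using h

theorem hasSum_eigenvalue_secondMoment (hz : StronglyMeasurable z) (hB : ∀ x, ‖z x‖ ^ 2 ≤ B) :
    HasSum (eigenvalue (secondMoment z P)) (∫ x, ‖z x‖ ^ 2 ∂P) := by
  obtain ⟨I, b, a, hI, hb, ha, hs, hr⟩ := exists_eigenbasis_secondMoment (P := P) hz hB
  have h := hr.tsum_eq
  rw [← ENNReal.ofReal_tsum_of_nonneg ha hs.summable, hs.tsum_eq] at h
  have hs' : Summable (eigenvalue (secondMoment z P)) := by
    have h1 := ENNReal.summable_toReal (h ▸ ENNReal.ofReal_ne_top)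
    simpa only [ENNReal.toReal_ofReal (eigenvalue_nonneg _ _)] using h1
  rw [← ENNReal.ofReal_tsum_of_nonneg (eigenvalue_nonneg _) hs'] at h
  rw [(ENNReal.ofReal_eq_ofReal_iff (tsum_nonneg (eigenvalue_nonneg _))
    (integral_nonneg fun x => by positivity)).1 h |>.symm]
  exact hs'.hasSum

/-- Eigenvectors with positive eigenvalue lie in the range, hence in `F`; being independent, they
number at most `finrank F`. -/
theorem eigenvalue_secondMoment_eq_zero (hz : StronglyMeasurable z) (hB : ∀ x, ‖z x‖ ^ 2 ≤ B)
    {F : Submodule ℝ H} [FiniteDimensional ℝ F] (hF : ∀ v, secondMoment z P v ∈ F) {j : ℕ}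
    (hj : Module.finrank ℝ F ≤ j) : eigenvalue (secondMoment z P) j = 0 := by
  obtain ⟨I, b, a, hI, hb, ha, hs, hr⟩ := exists_eigenbasis_secondMoment (P := P) hz hB
  refine le_antisymm (not_lt.1 fun h => ?_) (eigenvalue_nonneg _ _)
  rw [hr 0 le_rfl j, ← not_le] at h
  refine h ?_
  have hmem : ∀ i : {i | 0 < a i}, b i ∈ F := fun i => by
    have h1 : b i = (a i)⁻¹ • secondMoment z P (b i) := by
      rw [hb, smul_smul, inv_mul_cancel₀ (ne_of_gt i.2), one_smul]
    rw [h1]; exact F.smul_mem _ (hF _)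
  have hli : LinearIndependent ℝ fun i : {i | 0 < a i} => (⟨b i, hmem i⟩ : F) :=
    LinearIndependent.of_comp F.subtype
      (b.orthonormal.linearIndependent.comp _ Subtype.val_injective)
  have hfin : Finite {i | 0 < a i} := hli.finite
  have := Fintype.ofFinite {i | 0 < a i}
  rw [Set.encard_eq_coe_toFinset_card, Set.toFinset_card]
  exact_mod_cast hli.fintype_card_le_finrank.trans hj

end Spectral

/-! ### The Hoffman-Wielandt inequality -/

theorem ofReal_sub_sq_add {x y : ℝ} (hx : 0 ≤ x) (hy : 0 ≤ y) :
    ENNReal.ofReal ((x - y) ^ 2) + 2 * (ENNReal.ofReal x * ENNReal.ofReal y) =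
      ENNReal.ofReal (x ^ 2) + ENNReal.ofReal (y ^ 2) := by
  have h2 : (2 : ℝ≥0∞) = ENNReal.ofReal 2 := by simp
  rw [← ENNReal.ofReal_mul hx, h2, ← ENNReal.ofReal_mul zero_le_two,
    ← ENNReal.ofReal_add (sq_nonneg _) (by positivity),
    ← ENNReal.ofReal_add (sq_nonneg _) (sq_nonneg _)]
  congr 1; ring

theorem tsum_ofReal_sq_ne_top {I : Type*} {a : I → ℝ} (ha : ∀ i, 0 ≤ a i) (hs : Summable a) :
    ∑' i, ENNReal.ofReal (a i ^ 2) ≠ ∞ := by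
  have h1 : ∑' i, ENNReal.ofReal (a i) ≠ ∞ := by
    rw [← ENNReal.ofReal_tsum_of_nonneg ha hs]; exact ENNReal.ofReal_ne_top
  refine ne_top_of_le_ne_top (ENNReal.mul_ne_top h1 h1) ?_
  rw [← ENNReal.tsum_mul_right]
  refine ENNReal.tsum_le_tsum fun i => ?_
  rw [ENNReal.ofReal_pow (ha i), sq]
  gcongr
  exact ENNReal.le_tsum i

/-- For a doubly stochastic matrix `p`, pairing the decreasing rearrangements minimizes the
quadratic transport cost. -/
theorem IsRearrangement.tsum_sub_sq_le {I K : Type*} [Countable I] [Countable K]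
    {a : I → ℝ} {c : K → ℝ} {l m : ℕ → ℝ} (ha : IsRearrangement a l) (hc : IsRearrangement c m)
    (ha0 : ∀ i, 0 ≤ a i) (hc0 : ∀ k, 0 ≤ c k) (hl0 : ∀ j, 0 ≤ l j) (hm0 : ∀ j, 0 ≤ m j)
    (has : Summable a) (hcs : Summable c)
    {p : I → K → ℝ≥0∞} (hp : ∀ i, ∑' k, p i k = 1) (hp' : ∀ k, ∑' i, p i k = 1) :
    ∑' j, ENNReal.ofReal ((l j - m j) ^ 2) ≤
      ∑' i, ∑' k, ENNReal.ofReal ((a i - c k) ^ 2) * p i k := by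
  have hY := ha.tsum_mul_le hc (fun i => (hp i).le) (fun k => (hp' k).le)
  rw [ENNReal.tsum_prod'] at hY
  set X' := ∑' j, ENNReal.ofReal ((l j - m j) ^ 2)
  set Y' := ∑' j, ENNReal.ofReal (l j) * ENNReal.ofReal (m j)
  set X := ∑' i, ∑' k, ENNReal.ofReal ((a i - c k) ^ 2) * p i k
  set Y := ∑' i, ∑' k, ENNReal.ofReal (a i) * ENNReal.ofReal (c k) * p i k
  have h1 : X' + 2 * Y' =
      ∑' i, ENNReal.ofReal (a i ^ 2) + ∑' k, ENNReal.ofReal (c k ^ 2) := by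
    rw [← (ha.sq ha0 hl0).tsum_eq, ← (hc.sq hc0 hm0).tsum_eq, ← ENNReal.tsum_mul_left,
      ← ENNReal.tsum_add, ← ENNReal.tsum_add]
    exact tsum_congr fun j => ofReal_sub_sq_add (hl0 j) (hm0 j)
  have h2 : X + 2 * Y =
      ∑' i, ENNReal.ofReal (a i ^ 2) + ∑' k, ENNReal.ofReal (c k ^ 2) := by
    have e1 : ∑' i, ENNReal.ofReal (a i ^ 2) = ∑' i, ∑' k, ENNReal.ofReal (a i ^ 2) * p i k := by
      simp_rw [ENNReal.tsum_mul_left, hp, mul_one]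
    have e2 : ∑' k, ENNReal.ofReal (c k ^ 2) = ∑' i, ∑' k, ENNReal.ofReal (c k ^ 2) * p i k := by
      rw [ENNReal.tsum_comm]
      simp_rw [ENNReal.tsum_mul_left, hp', mul_one]
    rw [e1, e2, ← ENNReal.tsum_mul_left, ← ENNReal.tsum_add, ← ENNReal.tsum_add]
    refine tsum_congr fun i => ?_
    rw [← ENNReal.tsum_mul_left, ← ENNReal.tsum_add, ← ENNReal.tsum_add]
    refine tsum_congr fun k => ?_
    rw [← mul_assoc, ← add_mul, ← add_mul, ofReal_sub_sq_add (ha0 i) (hc0 k)]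
  -- From `X' + 2Y' = X + 2Y ≤ X + 2Y'` one must cancel `2Y'` in `[0, ∞]`; summability makes it
  -- finite.
  have h3 : 2 * Y' ≠ ∞ := by
    refine ne_top_of_le_ne_top ?_ (le_add_self (a := 2 * Y') (b := X'))
    rw [h1]
    exact ENNReal.add_ne_top.2 ⟨tsum_ofReal_sq_ne_top ha0 has, tsum_ofReal_sq_ne_top hc0 hcs⟩
  refine (ENNReal.add_le_add_iff_right h3).1 ?_
  rw [h1, ← h2]
  gcongr

section HoffmanWielandt

universe u

variable {H : Type u} [NormedAddCommGroup H] [InnerProductSpace ℝ H]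

theorem tsum_ofReal_inner_sq_eq_one {K : Type*} (c : HilbertBasis K ℝ H) {v : H} (hv : ‖v‖ = 1) :
    ∑' k, ENNReal.ofReal (inner ℝ v (c k) ^ 2) = 1 := by
  rw [← enorm_sq_eq_tsum, ← ofReal_norm, hv]; simp

variable [CompleteSpace H]

theorem tsum_enorm_sub_sq_eq {I K ι : Type*} (e : HilbertBasis ι ℝ H) (b : HilbertBasis I ℝ H)
    (c : HilbertBasis K ℝ H) {S T : H →L[ℝ] H} (hT : T.IsSymmetric) {a : I → ℝ} {w : K → ℝ}
    (hb : ∀ i, S (b i) = a i • b i) (hc : ∀ k, T (c k) = w k • c k) :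
    ∑' i, ‖(S - T) (e i)‖ₑ ^ 2 =
      ∑' i, ∑' k, ENNReal.ofReal ((a i - w k) ^ 2) * ENNReal.ofReal (inner ℝ (b i) (c k) ^ 2) := by
  -- Passing to the adjoint and back replaces the basis `e` by the eigenbasis `b`.
  rw [tsum_enorm_sq_eq e b, ← tsum_enorm_sq_eq b b]
  refine tsum_congr fun i => ?_
  rw [enorm_sq_eq_tsum c]
  refine tsum_congr fun k => ?_
  have h : inner ℝ (T (b i)) (c k) = inner ℝ (b i) (T (c k)) := hT (b i) (c k)
  rw [← ENNReal.ofReal_mul (sq_nonneg _), ← mul_pow, sub_apply, inner_sub_left,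
    h, hb, hc, inner_smul_left, inner_smul_right, conj_trivial, sub_mul]

variable [TopologicalSpace.SeparableSpace H] {𝒳 : Type*} [MeasurableSpace 𝒳] {z : 𝒳 → H}
  {P Q : Measure 𝒳} [IsProbabilityMeasure P] [IsProbabilityMeasure Q] {B : ℝ}

/-- The **Hoffman-Wielandt inequality** for second moment operators. -/
theorem tsum_eigenvalue_sub_sq_le {ι : Type*} (e : HilbertBasis ι ℝ H) (hz : StronglyMeasurable z)
    (hB : ∀ x, ‖z x‖ ^ 2 ≤ B) :
    ∑' j, ENNReal.ofReal ((eigenvalue (secondMoment z P) j - eigenvalue (secondMoment z Q) j) ^ 2)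
      ≤ ∑' i, ‖(secondMoment z P - secondMoment z Q) (e i)‖ₑ ^ 2 := by
  obtain ⟨I, b, a, hI, hb, ha, has, har⟩ := exists_eigenbasis_secondMoment (P := P) hz hB
  obtain ⟨K, c, w, hK, hc, hw, hws, hwr⟩ := exists_eigenbasis_secondMoment (P := Q) hz hB
  rw [tsum_enorm_sub_sq_eq e b c (isSymmetric_secondMoment hz hB) hb hc]
  refine har.tsum_sub_sq_le hwr ha hw (eigenvalue_nonneg _) (eigenvalue_nonneg _) has.summable
    hws.summable (fun i => tsum_ofReal_inner_sq_eq_one c (b.orthonormal.1 i)) fun k => ?_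
  simp_rw [fun i => real_inner_comm (c k) (b i)]
  exact tsum_ofReal_inner_sq_eq_one b (c.orthonormal.1 k)

end HoffmanWielandt

/-! ### The empirical measure -/

section Empirical

variable {H : Type*} [NormedAddCommGroup H] [InnerProductSpace ℝ H] [CompleteSpace H]
  {𝒳 : Type*} [MeasurableSpace 𝒳] {n : ℕ}

/-- The empirical measure of a finite sequence of points. -/
noncomputable def empiricalMeasure (x : Fin n → 𝒳) : Measure 𝒳 :=
  (n : ℝ≥0∞)⁻¹ • ∑ i, Measure.dirac (x i)

theorem isProbabilityMeasure_empiricalMeasure (hn : 0 < n) (x : Fin n → 𝒳) :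
    IsProbabilityMeasure (empiricalMeasure x) := ⟨by
  simp [empiricalMeasure, ENNReal.inv_mul_cancel (Nat.cast_ne_zero.2 hn.ne')
    (ENNReal.natCast_ne_top n)]⟩

theorem integral_empiricalMeasure {E : Type*} [NormedAddCommGroup E] [NormedSpace ℝ E]
    [CompleteSpace E] (x : Fin n → 𝒳) {f : 𝒳 → E} (hf : StronglyMeasurable f) :
    ∫ y, f y ∂(empiricalMeasure x) = (n : ℝ)⁻¹ • ∑ i, f (x i) := by
  rw [empiricalMeasure, integral_smul_measure, integral_finsetSum_measure fun i _ => ?_]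
  · simp [integral_dirac' _ _ hf]
  · exact integrable_dirac' hf (by simp)

theorem secondMoment_empiricalMeasure (x : Fin n → 𝒳) {z : 𝒳 → H} (hz : StronglyMeasurable z) :
    secondMoment z (empiricalMeasure x) = (n : ℝ)⁻¹ • ∑ i, rankOne ℝ (z (x i)) (z (x i)) := by
  have hc : Continuous fun v : H => rankOne ℝ v v :=
    (rankOne ℝ (E := H) (F := H)).continuous.clm_apply continuous_id
  exact integral_empiricalMeasure x (hc.comp_stronglyMeasurable hz)

theorem eigenvalue_secondMoment_empiricalMeasure_eq_zero [TopologicalSpace.SeparableSpace H]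
    (hn : 0 < n) (x : Fin n → 𝒳) {z : 𝒳 → H} {B : ℝ} (hz : StronglyMeasurable z)
    (hB : ∀ x, ‖z x‖ ^ 2 ≤ B) {j : ℕ} (hj : n ≤ j) :
    eigenvalue (secondMoment z (empiricalMeasure x)) j = 0 := by
  have := isProbabilityMeasure_empiricalMeasure hn x
  have := FiniteDimensional.span_of_finite ℝ (Set.finite_range fun i => z (x i))
  refine eigenvalue_secondMoment_eq_zero hz hB (F := Submodule.span ℝ (Set.range fun i => z (x i)))
    (fun v => ?_) ?_
  · rw [secondMoment_empiricalMeasure x hz, smul_apply,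
      sum_apply]
    refine Submodule.smul_mem _ _ (Submodule.sum_mem _ fun i _ => ?_)
    rw [rankOne_apply]
    exact Submodule.smul_mem _ _ (Submodule.subset_span ⟨i, rfl⟩)
  · refine le_trans (finrank_range_le_card _) ?_
    simpa using hj

end Empirical

/-! ### Pinelis' inequality in a Hilbert space -/

/-- The power series `∑ uⁿ / (2n)!` has nonnegative coefficients and each `uⁿ` is convex on `[0,
∞)`. -/
theorem convexOn_cosh_sqrt : ConvexOn ℝ (Set.Ici 0) fun u : ℝ => Real.cosh √u := by
  have hs : ∀ u ∈ Set.Ici (0 : ℝ), HasSum (fun n : ℕ => u ^ n / ((2 * n).factorial : ℝ))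
      (Real.cosh √u) := fun u hu => by
    have h := Real.hasSum_cosh √u
    simpa only [pow_mul, Real.sq_sqrt hu.out] using h
  refine ⟨convex_Ici 0, fun x hx y hy a b ha hb hab => ?_⟩
  have hxy : a • x + b • y ∈ Set.Ici (0 : ℝ) := convex_Ici 0 hx hy ha hb hab
  refine hasSum_le (fun n => ?_) (hs _ hxy) (((hs x hx).mul_left a).add ((hs y hy).mul_left b))
  have h := (convexOn_pow n).2 hx hy ha hb hab
  simp only [smul_eq_mul] at h ⊢
  rw [← mul_div_assoc, ← mul_div_assoc, ← add_div]
  gcongr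

theorem stronglyMeasurable_add_sum {E : Type*} [NormedAddCommGroup E] {𝒳 : Type*}
    [MeasurableSpace 𝒳] {V : 𝒳 → E} (hV : StronglyMeasurable V) {n : ℕ} (x : E) :
    StronglyMeasurable fun y : Fin n → 𝒳 => x + ∑ i, V (y i) :=
  stronglyMeasurable_const.add (Finset.stronglyMeasurable_fun_sum _ fun i _ =>
    hV.comp_measurable (measurable_pi_apply i))

section Pinelis

variable {E : Type*} [NormedAddCommGroup E] [InnerProductSpace ℝ E]

/-- The bound is affine in `d`, so its linear term vanishes on averaging over a centered `d`. It is
the chord of the convex function `cosh √u` between `(‖x‖ - c)²` and `(‖x‖ + c)²`. -/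
theorem cosh_norm_add_le {x d : E} {c : ℝ} (hc : 0 < c) (hx : x ≠ 0) (hd : ‖d‖ ≤ c) :
    Real.cosh ‖x + d‖ ≤ Real.cosh ‖x‖ * Real.cosh c +
      Real.sinh ‖x‖ * Real.sinh c / (‖x‖ * c) * inner ℝ x d := by
  have hx' : 0 < ‖x‖ := norm_pos_iff.2 hx
  set r := ‖x‖
  set s := inner ℝ x d
  have hs : |s| ≤ r * c := (abs_real_inner_le_norm x d).trans (by gcongr)
  have hrc : 0 < r * c := by positivity
  have hs' := abs_le.1 hs
  -- The weights make `α (r + c)² + β (r - c)²` equal to `r² + 2s + c²`, which bounds `‖x + d‖²`.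
  set α := (1 + s / (r * c)) / 2
  set β := (1 - s / (r * c)) / 2
  have h1 : |s / (r * c)| ≤ 1 := by rw [abs_div, abs_of_pos hrc]; exact (div_le_one hrc).2 hs
  have h1' := abs_le.1 h1
  have hα : 0 ≤ α := by simp only [α]; linarith
  have hβ : 0 ≤ β := by simp only [β]; linarith
  have hαβ : α + β = 1 := by simp only [α, β]; ring
  have hcv := convexOn_cosh_sqrt.2 (x := (r + c) ^ 2) (y := (r - c) ^ 2)
    (Set.mem_Ici.2 (sq_nonneg _)) (Set.mem_Ici.2 (sq_nonneg _)) hα hβ hαβ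
  simp only [smul_eq_mul, Real.sqrt_sq_eq_abs, Real.cosh_abs] at hcv
  have harg : α * (r + c) ^ 2 + β * (r - c) ^ 2 = r ^ 2 + 2 * s + c ^ 2 := by
    simp only [α, β]; field_simp; ring
  rw [harg] at hcv
  calc Real.cosh ‖x + d‖ ≤ Real.cosh √(r ^ 2 + 2 * s + c ^ 2) := by
        rw [Real.cosh_le_cosh, abs_of_nonneg (norm_nonneg _), abs_of_nonneg (Real.sqrt_nonneg _)]
        refine Real.le_sqrt_of_sq_le ?_
        rw [norm_add_sq_real]
        gcongr
    _ ≤ _ := hcv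
    _ = _ := by
        rw [Real.cosh_add, Real.cosh_sub]
        simp only [α, β]; field_simp; ring

variable {𝒳 : Type*} [MeasurableSpace 𝒳] {P : Measure 𝒳} [IsProbabilityMeasure P]

theorem lintegral_cosh_norm_add_le {V : 𝒳 → E} (hV : StronglyMeasurable V) {c : ℝ} (hc : 0 < c)
    (hVc : ∀ y, ‖V y‖ ≤ c) (hV0 : ∀ x, ∫ y, inner ℝ x (V y) ∂P = 0) (x : E) :
    ∫⁻ y, ENNReal.ofReal (Real.cosh ‖x + V y‖) ∂P ≤
      ENNReal.ofReal (Real.cosh ‖x‖ * Real.cosh c) := by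
  by_cases hx : x = 0
  · subst hx
    calc ∫⁻ y, ENNReal.ofReal (Real.cosh ‖0 + V y‖) ∂P
        ≤ ∫⁻ y, ENNReal.ofReal (Real.cosh c) ∂P := lintegral_mono fun y => by
          refine ENNReal.ofReal_le_ofReal ?_
          rw [zero_add, Real.cosh_le_cosh, abs_of_nonneg (norm_nonneg _), abs_of_pos hc]
          exact hVc y
      _ = _ := by simp
  · have hi : Integrable (fun y => inner ℝ x (V y)) P :=
      Integrable.of_bound (stronglyMeasurable_const.inner hV).aestronglyMeasurable (‖x‖ * c)
        (ae_of_all _ fun y => (norm_inner_le_norm _ _).trans (by gcongr; exact hVc y))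
    calc ∫⁻ y, ENNReal.ofReal (Real.cosh ‖x + V y‖) ∂P
        ≤ ∫⁻ y, ENNReal.ofReal (Real.cosh ‖x‖ * Real.cosh c +
            Real.sinh ‖x‖ * Real.sinh c / (‖x‖ * c) * inner ℝ x (V y)) ∂P :=
          lintegral_mono fun y => ENNReal.ofReal_le_ofReal (cosh_norm_add_le hc hx (hVc y))
      _ = ENNReal.ofReal (∫ y, (Real.cosh ‖x‖ * Real.cosh c +
            Real.sinh ‖x‖ * Real.sinh c / (‖x‖ * c) * inner ℝ x (V y)) ∂P) :=
          (ofReal_integral_eq_lintegral_ofReal ((integrable_const _).add (hi.const_mul _))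
            (ae_of_all _ fun y => (Real.cosh_pos _).le.trans
              (cosh_norm_add_le hc hx (hVc y)))).symm
      _ = _ := by
          rw [integral_add (integrable_const _) (hi.const_mul _),
            integral_const_mul _ fun y => inner ℝ x (V y), hV0]
          simp

/-- Each independent summand costs a factor `cosh c`. The starting point `x` is arbitrary so that
the induction can absorb the first summand into it. -/
theorem lintegral_pi_cosh_norm_add_sum_le {V : 𝒳 → E} (hV : StronglyMeasurable V) {c : ℝ}
    (hc : 0 < c) (hVc : ∀ y, ‖V y‖ ≤ c) (hV0 : ∀ x, ∫ y, inner ℝ x (V y) ∂P = 0) (n : ℕ) (x : E) :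
    ∫⁻ y, ENNReal.ofReal (Real.cosh ‖x + ∑ i, V (y i)‖) ∂(Measure.pi fun _ : Fin n => P) ≤
      ENNReal.ofReal (Real.cosh ‖x‖ * Real.cosh c ^ n) := by
  induction n generalizing x with
  | zero => simp
  | succ n ih =>
    have hm := (measurePreserving_piFinSuccAbove (fun _ : Fin (n + 1) => P) 0).symm
    have hmeas : ∀ (n : ℕ) (x : E), Measurable fun y : Fin n → 𝒳 =>
        ENNReal.ofReal (Real.cosh ‖x + ∑ i, V (y i)‖) := fun n x =>
      (Real.continuous_cosh.measurable.comp
        (stronglyMeasurable_add_sum hV x).norm.measurable).ennreal_ofReal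
    rw [← hm.lintegral_comp (hmeas _ x), lintegral_prod]
    swap
    · exact ((hmeas _ x).comp hm.measurable).aemeasurable
    calc _ = ∫⁻ y, ∫⁻ w, ENNReal.ofReal (Real.cosh ‖(x + V y) + ∑ i, V (w i)‖)
            ∂(Measure.pi fun _ : Fin n => P) ∂P := by
          refine lintegral_congr fun y => lintegral_congr fun w => ?_
          rw [Fin.sum_univ_succ, ← add_assoc]
          simp [MeasurableEquiv.piFinSuccAbove]
      _ ≤ ∫⁻ y, ENNReal.ofReal (Real.cosh ‖x + V y‖ * Real.cosh c ^ n) ∂P :=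
          lintegral_mono fun y => ih (x + V y)
      _ = (∫⁻ y, ENNReal.ofReal (Real.cosh ‖x + V y‖) ∂P) * ENNReal.ofReal (Real.cosh c ^ n) := by
          rw [← lintegral_mul_const']
          · simp_rw [ENNReal.ofReal_mul (Real.cosh_pos _).le]
          · exact ENNReal.ofReal_ne_top
      _ ≤ ENNReal.ofReal (Real.cosh ‖x‖ * Real.cosh c) * ENNReal.ofReal (Real.cosh c ^ n) := by
          gcongr
          exact lintegral_cosh_norm_add_le hV hc hVc hV0 x
      _ = _ := by
          rw [← ENNReal.ofReal_mul (by positivity)]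
          congr 1; ring

/-- **Pinelis' inequality** for sums of independent bounded centered random vectors. -/
theorem measureReal_lt_norm_sum_le {V : 𝒳 → E} (hV : StronglyMeasurable V) {c : ℝ}
    (hc : 0 < c) (hVc : ∀ y, ‖V y‖ ≤ c) (hV0 : ∀ x, ∫ y, inner ℝ x (V y) ∂P = 0) {n : ℕ}
    (hn : 0 < n) {t : ℝ} (ht : 0 ≤ t) :
    (Measure.pi fun _ : Fin n => P).real {y | t < ‖∑ i, V (y i)‖} ≤
      2 * Real.exp (-(t ^ 2 / (2 * n * c ^ 2))) := by
  have hn' : (0 : ℝ) < n := Nat.cast_pos.2 hn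
  set Q := Measure.pi fun _ : Fin n => P
  -- This scale minimizes the Chernoff exponent `n r² c² / 2 - r t`.
  set r := t / (n * c ^ 2)
  rcases ht.eq_or_lt with rfl | ht
  · refine (measureReal_le_one).trans ?_
    simp
  have hr : 0 < r := by positivity
  have h1 := lintegral_pi_cosh_norm_add_sum_le (P := P) (V := fun y => r • V y) (hV.const_smul r)
    (mul_pos hr hc) (fun y => by
      rw [norm_smul, Real.norm_of_nonneg hr.le]; gcongr; exact hVc y)
    (fun x => by simp_rw [inner_smul_right, integral_const_mul, hV0, mul_zero]) n 0
  have hmeas : Measurable fun y : Fin n → 𝒳 =>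
      ENNReal.ofReal (Real.cosh ‖0 + ∑ i, r • V (y i)‖) :=
    (Real.continuous_cosh.measurable.comp
      (stronglyMeasurable_add_sum (hV.const_smul r) 0).norm.measurable).ennreal_ofReal
  have h2 := mul_meas_ge_le_lintegral (μ := Q) hmeas (ENNReal.ofReal (Real.cosh (r * t)))
  have h3 : Q {y | t < ‖∑ i, V (y i)‖} ≤ Q {y | ENNReal.ofReal (Real.cosh (r * t)) ≤
      ENNReal.ofReal (Real.cosh ‖0 + ∑ i, r • V (y i)‖)} := by
    refine measure_mono fun y hy => ENNReal.ofReal_le_ofReal ?_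
    rw [zero_add, ← Finset.smul_sum, norm_smul, Real.norm_of_nonneg hr.le, Real.cosh_le_cosh,
      abs_of_pos (mul_pos hr ht), abs_of_nonneg (by positivity)]
    gcongr
    exact hy.out.le
  have h4 : ENNReal.ofReal (Real.cosh (r * t)) * Q {y | t < ‖∑ i, V (y i)‖} ≤
      ENNReal.ofReal (Real.cosh (r * c) ^ n) := by
    refine le_trans (by gcongr) (h2.trans (h1.trans_eq ?_))
    simp
  have h5 : Real.cosh (r * t) * Q.real {y | t < ‖∑ i, V (y i)‖} ≤ Real.cosh (r * c) ^ n := by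
    have := ENNReal.toReal_mono ENNReal.ofReal_ne_top h4
    rwa [ENNReal.toReal_mul, ENNReal.toReal_ofReal (Real.cosh_pos _).le,
      ENNReal.toReal_ofReal (by positivity)] at this
  -- The factor `2` in the tail bound comes from here.
  have h6 : Real.exp (r * t) / 2 ≤ Real.cosh (r * t) := by
    rw [Real.cosh_eq]; have := Real.exp_pos (-(r * t)); linarith
  have h7 : Real.cosh (r * c) ^ n ≤ Real.exp (n * ((r * c) ^ 2 / 2)) := by
    rw [Real.exp_nat_mul]
    exact pow_le_pow_left₀ (Real.cosh_pos _).le (Real.cosh_le_exp_half_sq _) n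
  have h8 : Real.exp (r * t) / 2 * Q.real {y | t < ‖∑ i, V (y i)‖} ≤
      Real.exp (n * ((r * c) ^ 2 / 2)) :=
    (mul_le_mul_of_nonneg_right h6 measureReal_nonneg).trans (h5.trans h7)
  have h9 : Real.exp (n * ((r * c) ^ 2 / 2)) =
      Real.exp (r * t) * Real.exp (-(t ^ 2 / (2 * n * c ^ 2))) := by
    rw [← Real.exp_add]
    congr 1
    simp only [r]; field_simp; ring
  rw [h9] at h8
  have := Real.exp_pos (r * t)
  refine le_of_mul_le_mul_left ?_ this
  linarith

theorem measureReal_mul_sqrt_lt_norm_sum_le {V : 𝒳 → E} (hV : StronglyMeasurable V) {c : ℝ}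
    (hc : 0 ≤ c) (hVc : ∀ y, ‖V y‖ ≤ c) (hV0 : ∀ x, ∫ y, inner ℝ x (V y) ∂P = 0) {n : ℕ}
    (hn : 0 < n) {δ : ℝ} (hδ : 0 ≤ δ) :
    (Measure.pi fun _ : Fin n => P).real {y | c * √(2 * n * δ) < ‖∑ i, V (y i)‖} ≤
      2 * Real.exp (-δ) := by
  rcases hc.eq_or_lt with rfl | hc
  · have h0 : ∀ y, V y = 0 := fun y => norm_le_zero_iff.1 (hVc y)
    simp [h0, Real.exp_nonneg]
  · have hn' : (0 : ℝ) < n := Nat.cast_pos.2 hn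
    refine (measureReal_lt_norm_sum_le hV hc hVc hV0 hn (by positivity)).trans_eq ?_
    rw [mul_pow, Real.sq_sqrt (by positivity)]
    congr 3
    field_simp

end Pinelis

/-! ### Rank-one operators as vectors of `ℓ²(ι, H)` -/

section TensorSquare

variable {H : Type*} [NormedAddCommGroup H] [InnerProductSpace ℝ H] {ι : Type*}

theorem hasSum_inner_smul_inner_smul (e : HilbertBasis ι ℝ H) (u v : H) :
    HasSum (fun i => inner ℝ (inner ℝ u (e i) • u) (inner ℝ v (e i) • v)) (inner ℝ u v ^ 2) := by
  have h := (e.hasSum_inner_mul_inner u v).mul_right (inner ℝ u v)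
  rw [← sq] at h
  have h' : ∀ i, inner ℝ (inner ℝ u (e i) • u) (inner ℝ v (e i) • v) =
      inner ℝ u (e i) * inner ℝ (e i) v * inner ℝ u v := fun i => by
    rw [inner_smul_left, inner_smul_right, conj_trivial, real_inner_comm v (e i)]
    ring
  simp_rw [h']
  exact h

/-- The operator `⟨·, v⟩ v`, represented by its values at the orthonormal basis `e`. -/
noncomputable def tensorSquare (e : HilbertBasis ι ℝ H) (v : H) : lp (fun _ : ι => H) 2 :=
  ⟨fun i => inner ℝ v (e i) • v, by
    refine memℓp_gen ?_
    have h := (hasSum_inner_smul_inner_smul e v v).summable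
    simp_rw [real_inner_self_eq_norm_sq] at h
    exact_mod_cast h⟩

/-- This identity yields the norm and continuity of `tensorSquare`, and the sign of the cross term
in `norm_centeredSquare_le`. -/
theorem inner_tensorSquare (e : HilbertBasis ι ℝ H) (u v : H) :
    inner ℝ (tensorSquare e u) (tensorSquare e v) = inner ℝ u v ^ 2 := by
  rw [lp.inner_eq_tsum]
  exact (hasSum_inner_smul_inner_smul e u v).tsum_eq

theorem norm_tensorSquare (e : HilbertBasis ι ℝ H) (v : H) : ‖tensorSquare e v‖ = ‖v‖ ^ 2 := by
  have h := inner_tensorSquare e v v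
  rw [real_inner_self_eq_norm_sq, real_inner_self_eq_norm_sq] at h
  exact (pow_left_inj₀ (norm_nonneg _) (sq_nonneg _) two_ne_zero).1 h

theorem continuous_tensorSquare (e : HilbertBasis ι ℝ H) : Continuous (tensorSquare e) := by
  rw [continuous_iff_continuousAt]
  intro u
  rw [ContinuousAt, tendsto_iff_norm_sub_tendsto_zero]
  have h : ∀ v, ‖tensorSquare e v - tensorSquare e u‖ =
      √((‖v‖ ^ 2) ^ 2 - 2 * inner ℝ v u ^ 2 + (‖u‖ ^ 2) ^ 2) := fun v => by
    rw [← norm_tensorSquare e v, ← norm_tensorSquare e u, ← inner_tensorSquare e,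
      ← norm_sub_sq_real, Real.sqrt_sq (norm_nonneg _)]
  simp_rw [h]
  have hc : Continuous fun v => √((‖v‖ ^ 2) ^ 2 - 2 * inner ℝ v u ^ 2 + (‖u‖ ^ 2) ^ 2) := by
    fun_prop
  convert hc.tendsto u using 2
  rw [real_inner_self_eq_norm_sq, eq_comm, Real.sqrt_eq_zero']
  exact le_of_eq (by ring)

theorem enorm_sq_eq_tsum_enorm_sq (f : lp (fun _ : ι => H) 2) : ‖f‖ₑ ^ 2 = ∑' i, ‖f i‖ₑ ^ 2 := by
  have h := lp.hasSum_inner (𝕜 := ℝ) f f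
  simp_rw [real_inner_self_eq_norm_sq] at h
  rw [← ofReal_norm, ← ENNReal.ofReal_pow (norm_nonneg _), ← h.tsum_eq,
    ENNReal.ofReal_tsum_of_nonneg (fun i => sq_nonneg _) h.summable]
  simp_rw [← ofReal_norm, ENNReal.ofReal_pow (norm_nonneg _)]

end TensorSquare

/-! ### Concentration of the operator and its trace -/

section Concentration

variable {H : Type*} [NormedAddCommGroup H] [InnerProductSpace ℝ H] {ι : Type*}
  {𝒳 : Type*} [MeasurableSpace 𝒳]

/-- The vector `(⟨·, z⟩ z - 𝔼[⟨·, z⟩ z], ‖z‖² - 𝔼 ‖z‖²)`. -/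
noncomputable def centeredSquare (e : HilbertBasis ι ℝ H) (z : 𝒳 → H) (P : Measure 𝒳) (x : 𝒳) :
    WithLp 2 (lp (fun _ : ι => H) 2 × ℝ) :=
  WithLp.toLp 2 (tensorSquare e (z x) - ∫ y, tensorSquare e (z y) ∂P,
    ‖z x‖ ^ 2 - ∫ y, ‖z y‖ ^ 2 ∂P)

variable {z : 𝒳 → H} {P : Measure 𝒳} {B : ℝ}

theorem stronglyMeasurable_centeredSquare (e : HilbertBasis ι ℝ H) (hz : StronglyMeasurable z) :
    StronglyMeasurable (centeredSquare e z P) := by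
  have hc : Continuous fun v : H => (WithLp.toLp 2 (tensorSquare e v - ∫ y, tensorSquare e (z y) ∂P,
      ‖v‖ ^ 2 - ∫ y, ‖z y‖ ^ 2 ∂P) : WithLp 2 (lp (fun _ : ι => H) 2 × ℝ)) :=
    (WithLp.prod_continuous_toLp 2 _ _).comp
      (((continuous_tensorSquare e).sub continuous_const).prodMk
        ((continuous_norm.pow 2).sub continuous_const))
  exact hc.comp_stronglyMeasurable hz

variable [IsProbabilityMeasure P]

theorem integrable_tensorSquare (e : HilbertBasis ι ℝ H) (hz : StronglyMeasurable z)
    (hB : ∀ x, ‖z x‖ ^ 2 ≤ B) : Integrable (fun x => tensorSquare e (z x)) P :=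
  Integrable.of_bound
    ((continuous_tensorSquare e).comp_stronglyMeasurable hz).aestronglyMeasurable B
    (ae_of_all _ fun x => by rw [norm_tensorSquare]; exact hB x)

variable [CompleteSpace H]

theorem integral_inner_centeredSquare (e : HilbertBasis ι ℝ H) (hz : StronglyMeasurable z)
    (hB : ∀ x, ‖z x‖ ^ 2 ≤ B) (w : WithLp 2 (lp (fun _ : ι => H) 2 × ℝ)) :
    ∫ x, inner ℝ w (centeredSquare e z P x) ∂P = 0 := by
  have h1 : Integrable (fun x => tensorSquare e (z x) - ∫ y, tensorSquare e (z y) ∂P) P :=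
    (integrable_tensorSquare e hz hB).sub (integrable_const _)
  have h2 : Integrable (fun x => ‖z x‖ ^ 2 - ∫ y, ‖z y‖ ^ 2 ∂P) P :=
    (integrable_norm_sq hz hB).sub (integrable_const _)
  simp_rw [centeredSquare, WithLp.prod_inner_apply]
  rw [integral_add (h1.const_inner (𝕜 := ℝ) w.ofLp.1) (h2.const_inner (𝕜 := ℝ) w.ofLp.2),
    integral_inner (𝕜 := ℝ) h1, integral_inner (𝕜 := ℝ) h2,
    integral_sub (integrable_tensorSquare e hz hB) (integrable_const _),
    integral_sub (integrable_norm_sq hz hB) (integrable_const _)]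
  simp

theorem norm_centeredSquare_le (e : HilbertBasis ι ℝ H) (hz : StronglyMeasurable z)
    (hB : ∀ x, ‖z x‖ ^ 2 ≤ B) (x : 𝒳) : ‖centeredSquare e z P x‖ ≤ √2 * B := by
  have hB0 : 0 ≤ B := (sq_nonneg _).trans (hB x)
  set M := ∫ y, tensorSquare e (z y) ∂P with hM
  set τ := ∫ y, ‖z y‖ ^ 2 ∂P
  have hτ0 : 0 ≤ τ := integral_nonneg fun y => sq_nonneg _
  have hτB : τ ≤ B := by
    refine (integral_mono (integrable_norm_sq hz hB) (integrable_const B) hB).trans ?_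
    simp
  have hMτ : ‖M‖ ≤ τ := by
    refine (norm_integral_le_integral_norm _).trans_eq ?_
    simp_rw [norm_tensorSquare]; rfl
  -- The cross term of the square is an average of squares `⟨z x, z y⟩²`, so it can be dropped; this
  -- keeps the constant at `√2 B`.
  have hin : 0 ≤ inner ℝ (tensorSquare e (z x)) M := by
    rw [hM, ← integral_inner (integrable_tensorSquare e hz hB)]
    exact integral_nonneg fun y => by rw [inner_tensorSquare]; exact sq_nonneg _
  have h : ‖centeredSquare e z P x‖ ^ 2 ≤ 2 * B ^ 2 := by
    rw [WithLp.prod_norm_sq_eq_of_L2]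
    change ‖tensorSquare e (z x) - M‖ ^ 2 + ‖‖z x‖ ^ 2 - τ‖ ^ 2 ≤ 2 * B ^ 2
    rw [norm_sub_sq_real, norm_tensorSquare, Real.norm_eq_abs, sq_abs]
    have hk := hB x
    have hk0 := sq_nonneg ‖z x‖
    generalize ‖z x‖ ^ 2 = k at *
    have hM2 : ‖M‖ ^ 2 ≤ τ ^ 2 := by gcongr
    -- What remains is `k² - kτ + τ² ≤ B²` for `k, τ ∈ [0, B]`.
    nlinarith [mul_nonneg hk0 (sub_nonneg.2 hk), mul_nonneg hτ0 (sub_nonneg.2 hτB),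
      mul_nonneg (sub_nonneg.2 hk) (sub_nonneg.2 hτB)]
  refine abs_le_of_sq_le_sq' ?_ (by positivity) |>.2
  rwa [mul_pow, Real.sq_sqrt zero_le_two]

theorem integral_tensorSquare_apply (e : HilbertBasis ι ℝ H) (hz : StronglyMeasurable z)
    (hB : ∀ x, ‖z x‖ ^ 2 ≤ B) (i : ι) :
    (∫ y, tensorSquare e (z y) ∂P) i = secondMoment z P (e i) := by
  rw [secondMoment_apply hz hB]
  exact ((lp.evalCLM ℝ (fun _ : ι => H) 2 i).integral_comp_comm
    (integrable_tensorSquare e hz hB)).symm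

variable {n : ℕ}

theorem smul_sum_centeredSquare {P : Measure 𝒳} (hn : 0 < n) (e : HilbertBasis ι ℝ H)
    (hz : StronglyMeasurable z) (y : Fin n → 𝒳) :
    (n : ℝ)⁻¹ • ∑ i, centeredSquare e z P (y i) =
      WithLp.toLp 2 (∫ x, tensorSquare e (z x) ∂(empiricalMeasure y) -
        ∫ x, tensorSquare e (z x) ∂P, ∫ x, ‖z x‖ ^ 2 ∂(empiricalMeasure y) - ∫ x, ‖z x‖ ^ 2 ∂P) := by
  have hn' : (n : ℝ) ≠ 0 := Nat.cast_ne_zero.2 hn.ne'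
  rw [integral_empiricalMeasure y ((continuous_tensorSquare e).comp_stronglyMeasurable hz),
    integral_empiricalMeasure y (f := fun x => ‖z x‖ ^ 2) (hz.norm.pow 2)]
  have key : ∀ {F : Type _} [AddCommGroup F] [Module ℝ F] (a : Fin n → F) (m : F),
      (n : ℝ)⁻¹ • ∑ i, (a i - m) = (n : ℝ)⁻¹ • ∑ i, a i - m := fun a m => by
    rw [Finset.sum_sub_distrib, Finset.sum_const, Finset.card_univ, Fintype.card_fin, smul_sub,
      ← Nat.cast_smul_eq_nsmul ℝ, inv_smul_smul₀ hn']
  simp_rw [centeredSquare]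
  rw [← WithLp.toLp_sum, ← WithLp.toLp_smul]
  congr 1
  refine Prod.ext ?_ ?_
  · rw [Prod.smul_fst, Prod.fst_sum]
    exact key _ _
  · rw [Prod.smul_snd, Prod.snd_sum, Finset.sum_sub_distrib]
    simp [mul_sub, hn']

theorem secondMoment_sub_le_of_norm_sum_le (hn : 0 < n) (e : HilbertBasis ι ℝ H)
    (hz : StronglyMeasurable z) (hB : ∀ x, ‖z x‖ ^ 2 ≤ B) {y : Fin n → 𝒳} {R : ℝ}
    (hy : ‖∑ i, centeredSquare e z P (y i)‖ ≤ n * R) :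
    ∑' i, ‖(secondMoment z P - secondMoment z (empiricalMeasure y)) (e i)‖ₑ ^ 2
        ≤ ENNReal.ofReal (R ^ 2) ∧
      |∫ x, ‖z x‖ ^ 2 ∂P - ∫ x, ‖z x‖ ^ 2 ∂(empiricalMeasure y)| ≤ R := by
  have hn' : (0 : ℝ) < n := Nat.cast_pos.2 hn
  have := isProbabilityMeasure_empiricalMeasure hn y
  have h : ‖(n : ℝ)⁻¹ • ∑ i, centeredSquare e z P (y i)‖ ≤ R := by
    rw [norm_smul, Real.norm_of_nonneg (by positivity)]
    exact (inv_mul_le_iff₀ hn').2 hy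
  have hR : 0 ≤ R := (norm_nonneg _).trans h
  rw [smul_sum_centeredSquare hn e hz] at h
  have h2 := pow_le_pow_left₀ (norm_nonneg _) h 2
  rw [WithLp.prod_norm_sq_eq_of_L2, WithLp.toLp_fst, WithLp.toLp_snd] at h2
  constructor
  · have h3 := ENNReal.ofReal_le_ofReal
      ((le_add_of_nonneg_right (sq_nonneg _)).trans h2)
    rw [ENNReal.ofReal_pow (norm_nonneg _), ofReal_norm, enorm_sq_eq_tsum_enorm_sq] at h3
    refine le_trans (le_of_eq (tsum_congr fun i => ?_)) h3
    rw [lp.coeFn_sub, Pi.sub_apply, integral_tensorSquare_apply e hz hB,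
      integral_tensorSquare_apply e hz hB, sub_apply, ← enorm_neg, neg_sub]
  · have h3 := (le_add_of_nonneg_left (sq_nonneg _)).trans h2
    rw [Real.norm_eq_abs, abs_sub_comm] at h3
    exact (pow_le_pow_iff_left₀ (abs_nonneg _) hR two_ne_zero).1 h3

end Concentration

theorem norm_feature_sq {H : Type*} [NormedAddCommGroup H] [InnerProductSpace ℝ H]
    [CompleteSpace H] {𝒳 : Type*} [RKHS ℝ H 𝒳 ℝ] (x : 𝒳) : ‖feature H x‖ ^ 2 = ker H x x := by
  rw [ker_eq_inner, real_inner_self_eq_norm_sq]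

/-- With probability at least `1 - 2 exp (-δ)`, the second moment operator and the trace of an
i.i.d. sample are close to those of the law. -/
theorem le_measureReal_secondMoment_sub {H : Type*} [NormedAddCommGroup H] [InnerProductSpace ℝ H]
    [CompleteSpace H] {ι : Type*} (e : HilbertBasis ι ℝ H) {𝒳 : Type*} [MeasurableSpace 𝒳]
    {z : 𝒳 → H} (hz : StronglyMeasurable z) {B : ℝ} (hB : ∀ x, ‖z x‖ ^ 2 ≤ B)
    {Ω : Type*} [MeasurableSpace Ω] {μ : Measure Ω} [IsProbabilityMeasure μ]
    {P : Measure 𝒳} [IsProbabilityMeasure P] {n : ℕ} (hn : 0 < n) {X : Fin n → Ω → 𝒳}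
    (hX : ∀ i, Measurable (X i)) (hlaw : ∀ i, μ.map (X i) = P) (hindep : iIndepFun X μ)
    {δ : ℝ} (hδ : 0 ≤ δ) {s : Set Ω}
    (hs : ∀ ω, ∑' i, ‖(secondMoment z P - secondMoment z (empiricalMeasure fun i => X i ω)) (e i)‖ₑ
          ^ 2 ≤ ENNReal.ofReal ((2 * B * √δ / √n) ^ 2) →
      |∫ x, ‖z x‖ ^ 2 ∂P - ∫ x, ‖z x‖ ^ 2 ∂(empiricalMeasure fun i => X i ω)| ≤ 2 * B * √δ / √n →
      ω ∈ s) :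
    1 - 2 * Real.exp (-δ) ≤ μ.real s := by
  obtain ⟨x₀⟩ : Nonempty 𝒳 := P.nonempty_of_neZero
  have hB0 : 0 ≤ B := (sq_nonneg _).trans (hB x₀)
  have hn' : (0 : ℝ) < n := Nat.cast_pos.2 hn
  set V := centeredSquare e z P
  have hV : StronglyMeasurable V := stronglyMeasurable_centeredSquare e hz
  have hP := measureReal_mul_sqrt_lt_norm_sum_le (P := P) hV (by positivity)
    (norm_centeredSquare_le e hz hB) (integral_inner_centeredSquare e hz hB) hn hδ
  set G : Set (Fin n → 𝒳) := {y | √2 * B * √(2 * n * δ) < ‖∑ i, V (y i)‖}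
  have hG : MeasurableSet G := by
    have h : StronglyMeasurable fun y : Fin n → 𝒳 => ∑ i, V (y i) :=
      Finset.stronglyMeasurable_fun_sum _ fun i _ => hV.comp_measurable (measurable_pi_apply i)
    exact measurableSet_lt measurable_const h.norm.measurable
  have hmap : MeasurePreserving (fun ω i => X i ω) μ (Measure.pi fun _ : Fin n => P) :=
    ⟨measurable_pi_lambda _ hX, by
      rw [(iIndepFun_iff_map_fun_eq_pi_map fun i => (hX i).aemeasurable).1 hindep]
      simp_rw [hlaw]⟩
  -- Measurability of `s` is not assumed, so its measure is bounded below through a measurable event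
  -- inside it. The radii agree: `√2 B √(2nδ) = n · (2B√δ/√n)`.
  have hsub : (fun ω i => X i ω) ⁻¹' Gᶜ ⊆ s := fun ω hω => by
    have h : ‖∑ i, V (X i ω)‖ ≤ n * (2 * B * √δ / √n) := by
      refine (not_lt.1 (show ¬ √2 * B * √(2 * n * δ) < ‖∑ i, V (X i ω)‖ from hω)).trans_eq ?_
      rw [mul_assoc 2, Real.sqrt_mul zero_le_two, Real.sqrt_mul hn'.le]
      have h2 := Real.mul_self_sqrt (zero_le_two (α := ℝ))
      have h3 := Real.mul_self_sqrt hn'.le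
      have h4 : √(n : ℝ) ≠ 0 := (Real.sqrt_pos.2 hn').ne'
      field_simp
      linear_combination B * √δ * √n * √n * h2 + 2 * B * √δ * h3
    obtain ⟨h1, h2⟩ := secondMoment_sub_le_of_norm_sum_le hn e hz hB h
    exact hs ω h1 h2
  calc 1 - 2 * Real.exp (-δ) ≤ 1 - (Measure.pi fun _ : Fin n => P).real G := by linarith
    _ = (Measure.pi fun _ : Fin n => P).real Gᶜ := (probReal_compl_eq_one_sub hG).symm
    _ = μ.real ((fun ω i => X i ω) ⁻¹' Gᶜ) :=
        (hmap.measureReal_preimage hG.compl.nullMeasurableSet).symm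
    _ ≤ μ.real s := measureReal_mono hsub

end CovOp

theorem mainTheorem7
    -- a separable real reproducing kernel Hilbert space `H` of functions on `𝒳`
    {𝒳 : Type*} [MeasurableSpace 𝒳]
    {H : Type*} [NormedAddCommGroup H] [InnerProductSpace ℝ H] [CompleteSpace H]
    [TopologicalSpace.SeparableSpace H] [MeasurableSpace H] [BorelSpace H] [RKHS ℝ H 𝒳 ℝ]
    -- with a measurable feature map and a bounded kernel
    (hφ : Measurable (CovOp.feature H : 𝒳 → H))
    (hbdd : BddAbove (Set.range fun x : 𝒳 => CovOp.ker H x x))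
    (B : ℝ) (hB : B = ⨆ x : 𝒳, CovOp.ker H x x)
    -- independent observations `X 1, …, X n` with the law `P`
    {Ω : Type*} [MeasurableSpace Ω] (μ : Measure Ω) [IsProbabilityMeasure μ]
    (P : Measure 𝒳) [IsProbabilityMeasure P]
    (n : ℕ) (hn : 0 < n) (X : Fin n → Ω → 𝒳) (hX : ∀ i, Measurable (X i))
    (hlaw : ∀ i, μ.map (X i) = P) (hindep : iIndepFun X μ)
    -- any orthonormal basis of `H`, in which Hilbert-Schmidt norms and traces are computed
    {ι : Type*} (e : HilbertBasis ι ℝ H)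
    (δ : ℝ) (hδ : 0 ≤ δ) :
    -- the covariance operator exists, and traces are sums of eigenvalues
    Integrable (fun x => rankOne ℝ (CovOp.feature H x) (CovOp.feature H x)) P ∧
    HasSum (fun j => CovOp.eigenvalue (CovOp.cov H P) j) (CovOp.trace e (CovOp.cov H P)) ∧
    (∀ ω, ∑ j ∈ Finset.range n, CovOp.eigenvalue (CovOp.empCov H fun i => X i ω) j
      = CovOp.trace e (CovOp.empCov H fun i => X i ω)) ∧
    -- with probability at least `1 - 2 exp (-δ)`, all the concentration bounds hold
    1 - 2 * Real.exp (-δ) ≤ μ.real {ω |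
      CovOp.hsENorm e (CovOp.cov H P - CovOp.empCov H fun i => X i ω)
          ≤ ENNReal.ofReal (2 * B * √δ / √n) ∧
      (∑' j, ENNReal.ofReal ((CovOp.eigenvalue (CovOp.cov H P) j
          - CovOp.eigenvalue (CovOp.empCov H fun i => X i ω) j) ^ 2))
          ≤ ENNReal.ofReal (4 * B ^ 2 * δ / n) ∧
      (⨆ j, ENNReal.ofReal |CovOp.eigenvalue (CovOp.cov H P) j
          - CovOp.eigenvalue (CovOp.empCov H fun i => X i ω) j|)
          ≤ ENNReal.ofReal (2 * B * √δ / √n) ∧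
      |CovOp.trace e (CovOp.cov H P) - CovOp.trace e (CovOp.empCov H fun i => X i ω)|
          ≤ 2 * B * √δ / √n} := by
  have hz : StronglyMeasurable (CovOp.feature H : 𝒳 → H) := hφ.stronglyMeasurable
  have hb : ∀ x : 𝒳, ‖CovOp.feature H x‖ ^ 2 ≤ B := fun x => by
    rw [CovOp.norm_feature_sq, hB]; exact le_ciSup hbdd x
  have hB0 : 0 ≤ B := by
    obtain ⟨x₀⟩ : Nonempty 𝒳 := P.nonempty_of_neZero
    exact (sq_nonneg _).trans (hb x₀)
  have hι : Countable ι := e.orthonormal.countable_of_separableSpace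
  have hprob := fun x : Fin n → 𝒳 => CovOp.isProbabilityMeasure_empiricalMeasure hn x
  have hemp : ∀ x : Fin n → 𝒳, CovOp.empCov H x =
      CovOp.secondMoment (CovOp.feature H) (CovOp.empiricalMeasure x) := fun x =>
    (CovOp.secondMoment_empiricalMeasure x hz).symm
  have hcov : CovOp.cov H P = CovOp.secondMoment (CovOp.feature H) P := rfl
  simp_rw [hemp, hcov, CovOp.trace_secondMoment e hz hb]
  refine ⟨CovOp.integrable_rankOne hz hb, CovOp.hasSum_eigenvalue_secondMoment hz hb,
    fun ω => ?_, CovOp.le_measureReal_secondMoment_sub e hz hb hn hX hlaw hindep hδ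
      fun ω h1 h2 => ?_⟩
  -- The empirical operator has rank at most `n`, so the eigenvalue series stops before index `n`.
  · refine (hasSum_sum_of_ne_finset_zero fun j hj => ?_).unique
      (CovOp.hasSum_eigenvalue_secondMoment hz hb)
    exact CovOp.eigenvalue_secondMoment_empiricalMeasure_eq_zero hn _ hz hb
      (by simpa using hj)
  · have hR : 0 ≤ 2 * B * √δ / √n := by positivity
    have h3 := (CovOp.tsum_eigenvalue_sub_sq_le e hz hb).trans h1
    refine ⟨?_, ?_, iSup_le fun j => ENNReal.ofReal_le_ofReal ?_, h2⟩
    · refine (ENNReal.rpow_le_rpow h1 (by norm_num)).trans_eq ?_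
      rw [ENNReal.ofReal_rpow_of_nonneg (by positivity) (by norm_num), ← Real.sqrt_eq_rpow,
        Real.sqrt_sq hR]
    · refine h3.trans_eq ?_
      rw [div_pow, mul_pow, mul_pow, Real.sq_sqrt hδ, Real.sq_sqrt (Nat.cast_nonneg n)]
      norm_num
    -- A single term of the `ℓ²` sum already controls each eigenvalue gap.
    · have h4 := (ENNReal.le_tsum j).trans h3
      rw [ENNReal.ofReal_le_ofReal_iff (sq_nonneg _)] at h4
      exact abs_le_of_sq_le_sq h4 hR
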